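/- **Proposition ($w$-recursion and $b$-recursion for the Hausdorff series).** Let $\boldsymbol{k}$ be a field of characteristic $0$. In the completed free associative algebra $\boldsymbol{k}\langle\langle X,Y\rangle\rangle$ the Hausdorff series $H(X,Y)$ is defined by $\exp(X)\exp(Y)=\exp(H(X,Y))$. Write $H(X,Y)=\sum_{w,b\ge 0}H_{w,b}(X,Y)$, where $H_{w,b}$ is a Lie polynomial (an element of the free Lie algebra on $X,Y$ over $\boldsymbol{k}$) of degree $w$ in $X$ and degree $b$ in $Y$; these $H_{w,b}$ exist and are uniquely determined (and $H_{0,0}=0$). Let $\mathfrak g$ be any Lie algebra over $\boldsymbol{k}$, let $X,Y\in\mathfrak g$, and write $H_{w,b}=H_{w,b}(X,Y)\in\mathfrak g$ for the values of these Lie polynomials. Let $B_n$ denote the Bernoulli numbers. Then for all integers $w,b\ge 0$ with $(w,b)\ne(0,0)$ the *$w$-recursion* $$(w+1)H_{w+1,b}=\tfrac12[X,H_{w,b}]+\sum_{r=0}^{\lfloor (w+b)/2\rfloor}\frac{B_{2r}}{(2r)!}\sum_{w_i,b_i}[H_{w_1,b_1},[\ldots,[H_{w_{2r},b_{2r}},X]\ldots]]$$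 and the *$b$-recursion* $$(b+1)H_{w,b+1}=-\tfrac12[Y,H_{w,b}]+\sum_{r=0}^{\lfloor (w+b)/2\rfloor}\frac{B_{2r}}{(2r)!}\sum_{w_i,b_i}[H_{w_1,b_1},[\ldots,[H_{w_{2r},b_{2r}},Y]\ldots]]$$ hold, where in both cases the inner sum runs over all $2r$-tuples of pairs $(w_i,b_i)\in\mathbb{Z}_{\ge0}^2\setminus\{(0,0)\}$, $1\le i\le 2r$, with $\sum_i w_i=w$ and $\sum_i b_i=b$ (so the term $r=0$ is zero). Moreover $H_{1,0}=X$, $H_{0,1}=Y$, $H_{0,b}=0$ for $b\ge2$ and $H_{w,0}=0$ for $w\ge2$. Each recursion separately determines $H$: let $(K_{w,b})_{(w,b)\ne(0,0)}$ be a family of elements of $\mathfrak g$. 1. If $K_{1,0}=X$, $K_{0,1}=Y$, $K_{0,b}=0$ for $b\ge 2$, and $K$ satisfies the $w$-recursion (with $K$ in place of $H$) for all $(w,b)\ne(0,0)$, then $K_{w,b}=H_{w,b}$ for all $(w,b)\neq(0,0)$. 2. If $K_{0,1}=Y$, $K_{1,0}=X$, $K_{w,0}=0$ for $w\ge 2$,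 and $K$ satisfies the $b$-recursion (with $K$ in place of $H$) for all $(w,b)\ne(0,0)$, then $K_{w,b}=H_{w,b}$ for all $(w,b)\neq(0,0)$. -/

import Mathlib

/-! ### The bigraded free Lie algebra on two generators and the Hausdorff series -/

universe u v

namespace HausdorffSeries

attribute [local instance 100] LieRing.ofAssociativeRing

/-- `IsLieMonomial k w b m`: the element `m` of the free Lie algebra on two generators
(`0` stands for `X` and `1` for `Y`) is an iterated bracket of generators in which
`X` occurs `w` times and `Y` occurs `b` times. -/
inductive IsLieMonomial (k : Type u) [Field k] : ℕ → ℕ → FreeLieAlgebra k (Fin 2) → Prop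
  | X : IsLieMonomial k 1 0 (FreeLieAlgebra.of k 0)
  | Y : IsLieMonomial k 0 1 (FreeLieAlgebra.of k 1)
  | lie {w b w' b' : ℕ} {m m' : FreeLieAlgebra k (Fin 2)} :
      IsLieMonomial k w b m → IsLieMonomial k w' b' m' →
        IsLieMonomial k (w + w') (b + b') ⁅m, m'⁆

/-- The Lie polynomials of degree `w` in `X` and degree `b` in `Y`. -/
noncomputable def bihomogeneous (k : Type u) [Field k] (w b : ℕ) : Submodule k (FreeLieAlgebra k (Fin 2)) :=
  Submodule.span k {m | IsLieMonomial k w b m}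

/-- The canonical map from the free Lie algebra on `X, Y` to the free associative algebra
`k⟨X, Y⟩` (with the commutator bracket). -/
noncomputable def toAssoc (k : Type u) [Field k] :
    FreeLieAlgebra k (Fin 2) →ₗ⁅k⁆ FreeAlgebra k (Fin 2) :=
  FreeLieAlgebra.lift k (FreeAlgebra.ι k)

/-- Formal power series in two commuting variables `s, t` (central; indices `0, 1`) with
coefficients in `k⟨X, Y⟩`.  A noncommutative formal power series `f` in `X, Y` with components
`f_{w,b}` of bidegree `(w, b)` is written as `∑ f_{w,b} s ^ w t ^ b`; this identifies the
completed free associative algebra `∏ k⟨X, Y⟩_{w,b}` with a subring. -/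
abbrev Series (k : Type u) [Field k] : Type u :=
  MvPowerSeries (Fin 2) (FreeAlgebra k (Fin 2))

/-- The exponential `∑ n, F ^ n / n!` of a formal power series `F` without constant term.
As `F ^ n` only has terms of total degree at least `n`, the coefficient at `d` is the finite sum
over `n ≤ |d|`. -/
noncomputable def expSeries {k : Type u} [Field k] (F : Series k) : Series k :=
  fun d => ∑ n ∈ Finset.range (d.degree + 1),
    ((n.factorial : k)⁻¹) • MvPowerSeries.coeff d (F ^ n)

/-- The family `H w b` of Lie polynomials consists of the bigraded components of the Hausdorff
series `H(X, Y) = ∑ H_{w,b}`: `H w b` has degree `w` in `X` and `b` in `Y`, and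
`exp X * exp Y = exp (H(X, Y))`. -/
def IsHausdorffSeries (k : Type u) [Field k] (H : ℕ → ℕ → FreeLieAlgebra k (Fin 2)) : Prop :=
  (∀ w b, H w b ∈ bihomogeneous k w b) ∧
  expSeries (MvPowerSeries.monomial (Finsupp.single 0 1) (FreeAlgebra.ι k 0) : Series k) *
      expSeries (MvPowerSeries.monomial (Finsupp.single 1 1) (FreeAlgebra.ι k 1) : Series k) =
    expSeries (fun d => toAssoc k (H (d 0) (d 1)) : Series k)

/-- The value `P(x, y)` of a Lie polynomial `P(X, Y)` at elements `x, y` of a Lie algebra. -/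
noncomputable def evalAt (k : Type u) [Field k] {L : Type v} [LieRing L] [LieAlgebra k L]
    (x y : L) (P : FreeLieAlgebra k (Fin 2)) : L :=
  FreeLieAlgebra.lift k ![x, y] P

/-- The sum
`∑_r B_{2r} / (2r)! ∑ [K_{w_1,b_1}, [K_{w_2,b_2}, …, [K_{w_{2r},b_{2r}}, z] … ]]`,
where the inner sum runs over all `2r`-tuples of pairs `(w_i, b_i) ≠ (0, 0)` with
`∑ w_i = w` and `∑ b_i = b`.  There are none unless `2 r ≤ w + b`. -/
noncomputable def bernoulliSum (k : Type u) [Field k] {L : Type v} [LieRing L] [LieAlgebra k L]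
    (K : ℕ → ℕ → L) (z : L) (w b : ℕ) : L :=
  ∑ r ∈ Finset.range ((w + b) / 2 + 1),
    (((bernoulli (2 * r) : ℚ) : k) / ((2 * r).factorial : k)) •
      ∑ ws ∈ Finset.Nat.antidiagonalTuple (2 * r) w,
        ∑ bs ∈ (Finset.Nat.antidiagonalTuple (2 * r) b).filter
            (fun bs => ∀ i, (ws i, bs i) ≠ (0, 0)),
          (List.ofFn fun i => K (ws i) (bs i)).foldr (fun a c => ⁅a, c⁆) z

/-- The `w`-recursion, for all pairs `(w, b) ≠ (0, 0)`. -/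
def WRecursion (k : Type u) [Field k] {L : Type v} [LieRing L] [LieAlgebra k L]
    (x : L) (K : ℕ → ℕ → L) : Prop :=
  ∀ w b : ℕ, (w, b) ≠ (0, 0) →
    ((w : k) + 1) • K (w + 1) b = (1 / 2 : k) • ⁅x, K w b⁆ + bernoulliSum k K x w b

/-- The `b`-recursion, for all pairs `(w, b) ≠ (0, 0)`. -/
def BRecursion (k : Type u) [Field k] {L : Type v} [LieRing L] [LieAlgebra k L]
    (y : L) (K : ℕ → ℕ → L) : Prop :=
  ∀ w b : ℕ, (w, b) ≠ (0, 0) →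
    ((b : k) + 1) • K w (b + 1) = -(1 / 2 : k) • ⁅y, K w b⁆ + bernoulliSum k K y w b

/-- The initial values for the `w`-recursion: the line `w = 0`, and `K_{1,0}`. -/
def WInitial {L : Type v} [LieRing L] (x y : L) (K : ℕ → ℕ → L) : Prop :=
  K 1 0 = x ∧ K 0 1 = y ∧ ∀ b, 2 ≤ b → K 0 b = 0

/-- The initial values for the `b`-recursion: the line `b = 0`, and `K_{0,1}`. -/
def BInitial {L : Type v} [LieRing L] (x y : L) (K : ℕ → ℕ → L) : Prop :=
  K 0 1 = y ∧ K 1 0 = x ∧ ∀ w, 2 ≤ w → K w 0 = 0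

end HausdorffSeries

/-!
The components of the Hausdorff series are constructed by solving the recursion, and the proof
that the solution exponentiates to `exp X * exp Y` is a differential equation.

Let `θ` be the derivation of the ring of power series that multiplies the terms of degree `w` in
`X` by `w`. For a series `F` of Lie polynomials the `w`-recursion says exactly that
`θ F = (ad F / (e ^ (ad F) - 1)) X` (`euler_toSeries`): the coefficients of `z / (e ^ z - 1)` are
`B_n / n!`, and `B_n` vanishes for odd `n > 1`. On the other hand, if `a` and `b` denote left and
right multiplication by `F`, then `θ (e ^ F) = ((e ^ a - e ^ b) / (a - b)) (θ F)`. As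
`ad F = a - b`, the two factors cancel and `θ (e ^ F) = X * e ^ F` (`coeff_euler_expSeries`,
resting on the polynomial identity `sum_bernoulliCoeff_mul_geom_sum`). The product
`e ^ X * e ^ Y` solves the same equation, and both sides agree in degree `0` in `X`, so they are
equal (`exp_mul_exp_eq_of_wRecursion`). The `b`-recursion is treated in the same way with the
derivation that counts `Y`, and with `a` and `b` interchanged. In particular the theorem that the
Hausdorff series consists of Lie polynomials is a consequence, since the recursion is formulated
in the free Lie algebra.

Uniqueness needs two facts. The exponential is injective on series without constant term
(`expSeries_injective`). And a bihomogeneous Lie polynomial is determined by its image in the free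
associative algebra (`eq_zero_of_toAssoc_eq_zero`): the free Lie algebra `L` acts on `L × k` in
such a way that `P` of bidegree `(w, b)` sends `(0, 1)` to `((w + b) P, 0)`, and this action
extends to the free associative algebra. No form of the Poincaré–Birkhoff–Witt theorem is used.

Hence any Hausdorff series is the solution of both recursions in the free Lie algebra. Evaluation
at `x, y` in a Lie algebra preserves the recursions, and each recursion has at most one solution
with given initial values, because its right-hand side only involves earlier terms.
-/

attribute [local instance 100] LieRing.ofAssociativeRing

namespace HausdorffSeries

/-! ### The Bernoulli identity -/

section Bernoulli

/-- The coefficient `B_n / n!` of the power series `z / (e ^ z - 1)`, in the field `k`. -/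
noncomputable def bernoulliCoeff (k : Type u) [Field k] (n : ℕ) : k :=
  ((bernoulli n : ℚ) : k) / (n.factorial : k)

open PowerSeries in
/-- The identity `(e ^ (a z) - e ^ (b z)) * B((a - b) z) = (a - b) z e ^ (b z)`, where
`B(z) = z / (e ^ z - 1)`. -/
theorem exp_sub_exp_mul_bernoulli {A : Type*} [CommRing A] [Algebra ℚ A] (a b : A) :
    (rescale a (exp A) - rescale b (exp A)) * rescale (a - b) (bernoulliPowerSeries A) =
      C (a - b) * X * rescale b (exp A) := by
  have h := congrArg (rescale (a - b)) (bernoulliPowerSeries_mul_exp_sub_one A)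
  rw [map_mul, map_sub, map_one, rescale_X] at h
  have h2 := exp_mul_exp_eq_exp_add (A := A) (a - b) b
  rw [sub_add_cancel] at h2
  rw [← h2, ← h]
  ring

open Polynomial in
/-- The identity `(e ^ a - e ^ b) / (a - b) * ((a - b) / (e ^ (a - b) - 1)) = e ^ b`, degree by
degree, for commuting elements of a `k`-algebra. -/
theorem sum_bernoulliCoeff_mul_geom_sum (k : Type u) [Field k] [CharZero k] {E : Type*} [Ring E]
    [Algebra k E] {a b : E} (hab : Commute a b) (n : ℕ) :
    ∑ p ∈ Finset.HasAntidiagonal.antidiagonal n,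
      ((((p.1 + 1).factorial : k)⁻¹ * bernoulliCoeff k p.2) •
        ((∑ j ∈ Finset.range (p.1 + 1), a ^ j * b ^ (p.1 - j)) * (a - b) ^ p.2)) =
      (n.factorial : k)⁻¹ • b ^ n := by
  -- It suffices to treat the two variables of a polynomial ring, where `a - b` can be cancelled.
  have key : ∑ p ∈ Finset.HasAntidiagonal.antidiagonal n,
      ((((p.1 + 1).factorial : k)⁻¹ * bernoulliCoeff k p.2) •
        ((∑ j ∈ Finset.range (p.1 + 1), (C X : k[X][X]) ^ j * X ^ (p.1 - j)) * (C X - X) ^ p.2)) =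
      (n.factorial : k)⁻¹ • (X : k[X][X]) ^ n := by
    have hne : (C X - X : k[X][X]) ≠ 0 := by
      intro h
      have := congrArg (fun q => Polynomial.coeff q 1) h
      simp at this
    apply mul_left_cancel₀ hne
    have h := congrArg (PowerSeries.coeff (n + 1))
      (exp_sub_exp_mul_bernoulli (C X : k[X][X]) X)
    have hr : PowerSeries.coeff (n + 1)
        (PowerSeries.C (C X - X : k[X][X]) * PowerSeries.X *
          PowerSeries.rescale (X : k[X][X]) (PowerSeries.exp k[X][X])) =
        (C X - X) * ((n.factorial : k)⁻¹ • (X : k[X][X]) ^ n) := by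
      rw [mul_assoc, PowerSeries.coeff_C_mul, PowerSeries.coeff_succ_X_mul,
        PowerSeries.coeff_rescale, PowerSeries.coeff_exp, Algebra.smul_def,
        IsScalarTower.algebraMap_apply ℚ k k[X][X]]
      simp only [eq_ratCast, one_div, Rat.cast_inv, Rat.cast_natCast]
      ring
    rw [hr, PowerSeries.coeff_mul, Finset.Nat.antidiagonal_succ, Finset.sum_cons] at h
    rw [← h, Finset.mul_sum]
    simp only [PowerSeries.coeff_rescale, map_sub, pow_zero, sub_self, zero_mul, zero_add,
      Finset.sum_map, Function.Embedding.prodMap, Function.Embedding.coeFn_mk, Prod.map]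
    refine Finset.sum_congr rfl fun p _ => ?_
    simp only [Nat.succ_eq_add_one, Function.Embedding.refl_apply, PowerSeries.coeff_exp,
      bernoulliPowerSeries, PowerSeries.coeff_mk, ← sub_mul]
    rw [← geom_sum₂_mul, IsScalarTower.algebraMap_apply ℚ k k[X][X],
      IsScalarTower.algebraMap_apply ℚ k k[X][X], Algebra.smul_def, map_mul, bernoulliCoeff]
    simp only [add_tsub_cancel_right, eq_ratCast, Rat.cast_div, Rat.cast_natCast,
      one_div, Rat.cast_inv]
    ring
  have hc : ∀ q, Commute ((aeval a : k[X] →ₐ[k] E).toRingHom q) b := fun q => by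
    induction q using Polynomial.induction_on' with
    | add p q hp hq => simpa using hp.add_left hq
    | monomial m r =>
      simpa [aeval_monomial] using (Algebra.commute_algebraMap_left r b).mul_left (hab.pow_left m)
  obtain ⟨φ, hs, hC, hX⟩ : ∃ φ : k[X][X] →+* E, (∀ (r : k) q, φ (r • q) = r • φ q) ∧
      φ (C X) = a ∧ φ X = b := by
    refine ⟨eval₂RingHom' (aeval a : k[X] →ₐ[k] E).toRingHom b hc, fun r q => ?_, by simp, by simp⟩
    rw [Algebra.smul_def, map_mul, Algebra.smul_def]
    congr 1
    simp [Polynomial.algebraMap_apply]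
  simpa only [map_sum, hs, map_mul, map_pow, map_sub, hC, hX] using congrArg φ key

theorem bernoulliCoeff_zero (k : Type u) [Field k] : bernoulliCoeff k 0 = 1 := by
  simp [bernoulliCoeff]

theorem bernoulliCoeff_one (k : Type u) [Field k] [CharZero k] :
    bernoulliCoeff k 1 = -(1 / 2) := by
  simp [bernoulliCoeff]; ring

theorem bernoulliCoeff_odd (k : Type u) [Field k] {n : ℕ} (hn : Odd n) (h : 1 < n) :
    bernoulliCoeff k n = 0 := by
  simp [bernoulliCoeff, bernoulli_eq_zero_of_odd hn h]

end Bernoulli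

/-! ### Exponentials of formal power series and the Euler derivations -/

section Series

open MvPowerSeries

variable {k : Type u} [Field k]

theorem coeff_smul_field (r : k) (d : Fin 2 →₀ ℕ) (f : Series k) :
    coeff d (r • f) = r • coeff d f := rfl

theorem constantCoeff_eq_zero_iff_one_le_order {f : Series k} :
    f.constantCoeff = 0 ↔ 1 ≤ f.order := one_le_order_iff_constCoeff_eq_zero.symm

theorem le_order_sum {ι : Type*} (s : Finset ι) (f : ι → Series k) {N : ℕ∞}
    (h : ∀ i ∈ s, N ≤ (f i).order) : N ≤ (∑ i ∈ s, f i).order := by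
  refine le_order fun d hd => ?_
  rw [map_sum]
  exact Finset.sum_eq_zero fun i hi => coeff_of_lt_order (hd.trans_le (h i hi))

theorem natCast_le_order_pow {F : Series k} (hF : F.constantCoeff = 0) (n : ℕ) :
    (n : ℕ∞) ≤ (F ^ n).order :=
  le_order_pow_of_constantCoeff_eq_zero n hF

/-- The coefficients of `expSeries F` can be computed from any sufficiently long partial sum. -/
theorem coeff_expSeries {F : Series k} (hF : F.constantCoeff = 0) {d : Fin 2 →₀ ℕ} {N : ℕ}
    (hN : d.degree < N) :
    coeff d (expSeries F) = ∑ n ∈ Finset.range N, (n.factorial : k)⁻¹ • coeff d (F ^ n) := by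
  rw [coeff_apply, expSeries]
  refine Finset.sum_subset (Finset.range_subset_range.2 hN) fun n _ hn => ?_
  rw [coeff_of_lt_order, smul_zero]
  refine lt_of_lt_of_le ?_ (natCast_le_order_pow hF n)
  rw [Finset.mem_range] at hn
  exact_mod_cast (by omega : d.degree < n)

theorem le_order_expSeries_sub {F : Series k} (hF : F.constantCoeff = 0) (N : ℕ) :
    (N : ℕ∞) ≤ (expSeries F - ∑ n ∈ Finset.range N, (n.factorial : k)⁻¹ • F ^ n).order := by
  refine nat_le_order fun d hd => ?_
  rw [map_sub, coeff_expSeries hF hd, map_sum, sub_eq_zero]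
  rfl

/-- The Euler derivation `s ∂/∂s` (for `i = 0`) or `t ∂/∂t` (for `i = 1`), which multiplies
the terms of degree `n` in the `i`-th variable by `n`. -/
noncomputable def euler (k : Type u) [Field k] (i : Fin 2) : Series k →ₗ[k] Series k where
  toFun f := fun d => (d i : k) • coeff d f
  map_add' f g := by ext d; exact smul_add _ _ _
  map_smul' r f := by ext d; exact smul_comm (d i : k) r (coeff d f)

theorem coeff_euler (i : Fin 2) (f : Series k) (d : Fin 2 →₀ ℕ) :
    coeff d (euler k i f) = (d i : k) • coeff d f := rfl

theorem euler_mul (i : Fin 2) (f g : Series k) :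
    euler k i (f * g) = euler k i f * g + f * euler k i g := by
  ext d
  rw [coeff_euler, map_add, coeff_mul, coeff_mul, coeff_mul, Finset.smul_sum,
    ← Finset.sum_add_distrib]
  refine Finset.sum_congr rfl fun p hp => ?_
  rw [← Finset.HasAntidiagonal.mem_antidiagonal.1 hp, coeff_euler, coeff_euler,
    Finsupp.add_apply, Nat.cast_add, add_smul, smul_mul_assoc, mul_smul_comm]

theorem euler_one (i : Fin 2) : euler k i (1 : Series k) = 0 := by
  ext d
  rw [coeff_euler, coeff_one]
  split_ifs with h <;> simp [h]

theorem euler_pow_succ (i : Fin 2) (F : Series k) (n : ℕ) :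
    euler k i (F ^ (n + 1)) =
      ∑ j ∈ Finset.range (n + 1), F ^ j * euler k i F * F ^ (n - j) := by
  induction n with
  | zero => simp
  | succ n ih =>
    rw [pow_succ, euler_mul, ih, Finset.sum_range_succ _ (n + 1), Finset.sum_mul, Nat.sub_self,
      pow_zero, mul_one]
    congr 1
    refine Finset.sum_congr rfl fun j hj => ?_
    rw [Finset.mem_range] at hj
    rw [mul_assoc, ← pow_succ, show n - j + 1 = n + 1 - j by omega]

/-- An operator on power series that raises the order. -/
def RaisesOrder (T : Module.End k (Series k)) : Prop :=
  ∀ f, f.order + 1 ≤ (T f).order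

theorem RaisesOrder.pow {T : Module.End k (Series k)} (hT : RaisesOrder T) (n : ℕ)
    (f : Series k) : f.order + n ≤ ((T ^ n) f).order := by
  induction n with
  | zero => simp
  | succ n ih =>
    rw [pow_succ', Module.End.mul_apply, Nat.cast_succ, ← add_assoc]
    exact (add_le_add_left ih 1).trans (hT _)

theorem RaisesOrder.sub {T U : Module.End k (Series k)} (hT : RaisesOrder T)
    (hU : RaisesOrder U) : RaisesOrder (T - U) := fun f => by
  rw [LinearMap.sub_apply, sub_eq_add_neg]
  refine le_trans ?_ min_order_le_add
  rw [order_neg]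
  exact le_min (hT f) (hU f)

theorem raisesOrder_mulLeft {F : Series k} (hF : F.constantCoeff = 0) :
    RaisesOrder (LinearMap.mulLeft k F) := fun f => by
  refine le_trans ?_ le_order_mul
  rw [add_comm]
  exact add_le_add_left (constantCoeff_eq_zero_iff_one_le_order.1 hF) _

theorem raisesOrder_mulRight {F : Series k} (hF : F.constantCoeff = 0) :
    RaisesOrder (LinearMap.mulRight k F) := fun f => by
  refine le_trans ?_ le_order_mul
  exact add_le_add_right (constantCoeff_eq_zero_iff_one_le_order.1 hF) _

theorem sum_range_sum_range_eq_sum_antidiagonal {M : Type*} [AddCommMonoid M] (N : ℕ)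
    (g : ℕ → ℕ → M) (hg : ∀ n m, N ≤ n + m → g n m = 0) :
    ∑ n ∈ Finset.range N, ∑ m ∈ Finset.range N, g n m =
      ∑ q ∈ Finset.range N, ∑ p ∈ Finset.HasAntidiagonal.antidiagonal q, g p.1 p.2 := by
  simp_rw [Finset.Nat.sum_antidiagonal_eq_sum_range_succ g, Finset.sum_range_diag_flip]
  refine Finset.sum_congr rfl fun n _ => ?_
  refine (Finset.sum_subset (Finset.range_subset_range.2 (Nat.sub_le N n)) fun m _ hm => ?_).symm
  rw [Finset.mem_range] at hm
  exact hg n m (by omega)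

theorem coeff_eq_of_le_order_sub {f g : Series k} {N : ℕ} (h : (N : ℕ∞) ≤ (f - g).order)
    {d : Fin 2 →₀ ℕ} (hd : d.degree < N) : coeff d f = coeff d g := by
  rw [← sub_eq_zero, ← map_sub]
  exact coeff_of_lt_order (lt_of_lt_of_le (by exact_mod_cast hd) h)

/-- Let `a, b` be left and right multiplication by `F`, in either order. If
`θ F = ((a - b) / (e ^ (a - b) - 1)) Z` for an Euler derivation `θ`, then `θ (e ^ F) = e ^ b Z`:
indeed `θ (e ^ F) = ((e ^ a - e ^ b) / (a - b)) (θ F)`. -/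
theorem coeff_euler_expSeries [CharZero k] (i : Fin 2) {F Z : Series k}
    (hF : F.constantCoeff = 0) {a b : Module.End k (Series k)}
    (hab : a = LinearMap.mulLeft k F ∧ b = LinearMap.mulRight k F ∨
      a = LinearMap.mulRight k F ∧ b = LinearMap.mulLeft k F)
    (hθ : ∀ N : ℕ, (N : ℕ∞) ≤
      (euler k i F - ∑ m ∈ Finset.range N, bernoulliCoeff k m • ((a - b) ^ m) Z).order)
    {d : Fin 2 →₀ ℕ} {N : ℕ} (hd : d.degree < N) :
    coeff d (euler k i (expSeries F)) =
      coeff d (∑ n ∈ Finset.range N, (n.factorial : k)⁻¹ • (b ^ n) Z) := by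
  have hcomm : Commute a b := by
    rcases hab with ⟨rfl, rfl⟩ | ⟨rfl, rfl⟩
    · exact LinearMap.commute_mulLeft_right F F
    · exact (LinearMap.commute_mulLeft_right F F).symm
  have ha : RaisesOrder a := by
    rcases hab with ⟨rfl, -⟩ | ⟨rfl, -⟩
    exacts [raisesOrder_mulLeft hF, raisesOrder_mulRight hF]
  have hb : RaisesOrder b := by
    rcases hab with ⟨-, rfl⟩ | ⟨-, rfl⟩
    exacts [raisesOrder_mulRight hF, raisesOrder_mulLeft hF]
  -- `S n` is `(a ^ (n + 1) - b ^ (n + 1)) / (a - b)`, so that `θ (F ^ (n + 1)) = S n (θ F)`.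
  set S : ℕ → Module.End k (Series k) :=
    fun n => ∑ j ∈ Finset.range (n + 1), a ^ j * b ^ (n - j) with hS
  have hpow : ∀ n, euler k i (F ^ (n + 1)) = S n (euler k i F) := fun n => by
    rw [euler_pow_succ, hS]
    simp only [LinearMap.sum_apply, Module.End.mul_apply]
    rcases hab with ⟨rfl, rfl⟩ | ⟨rfl, rfl⟩
    · simp only [LinearMap.pow_mulLeft, LinearMap.pow_mulRight, LinearMap.mulLeft_apply,
        LinearMap.mulRight_apply, mul_assoc]
    · simp only [LinearMap.pow_mulLeft, LinearMap.pow_mulRight, LinearMap.mulLeft_apply,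
        LinearMap.mulRight_apply]
      rw [← Finset.sum_range_reflect]
      refine Finset.sum_congr rfl fun j hj => ?_
      rw [Finset.mem_range] at hj
      rw [show n + 1 - 1 - j = n - j by omega, show n - (n - j) = j by omega]
  have hSord : ∀ n f, f.order + n ≤ (S n f).order := fun n f => by
    rw [hS]
    simp only [LinearMap.sum_apply, Module.End.mul_apply]
    refine le_order_sum _ _ fun j hj => ?_
    refine le_trans ?_ (ha.pow j _)
    refine le_trans ?_ (add_le_add_left (hb.pow (n - j) f) _)
    rw [Finset.mem_range] at hj
    rw [add_assoc, ← Nat.cast_add, show n - j + j = n by omega]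
  have h1 : coeff d (euler k i (expSeries F)) = ∑ n ∈ Finset.range N,
      ((n + 1).factorial : k)⁻¹ • coeff d (S n (euler k i F)) := by
    rw [coeff_euler, coeff_expSeries hF (hd.trans (Nat.lt_succ_self N)), Finset.sum_range_succ',
      smul_add, Finset.smul_sum]
    have h0 : (d i : k) • ((Nat.factorial 0 : k)⁻¹ • coeff d (F ^ 0)) = 0 := by
      rw [smul_comm, pow_zero, ← coeff_euler, euler_one, map_zero, smul_zero]
    rw [h0, add_zero]
    refine Finset.sum_congr rfl fun n _ => ?_
    rw [smul_comm, ← coeff_euler, hpow]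
  -- Up to order `N`, `θ F` may be replaced by the partial sum of its Bernoulli expansion.
  have h2 : ∀ n, coeff d (S n (euler k i F)) =
      ∑ m ∈ Finset.range N, bernoulliCoeff k m • coeff d ((S n * (a - b) ^ m) Z) := fun n => by
    have : (N : ℕ∞) ≤ (S n (euler k i F) -
        S n (∑ m ∈ Finset.range N, bernoulliCoeff k m • ((a - b) ^ m) Z)).order := by
      rw [← map_sub]
      exact (hθ N).trans (le_self_add.trans (hSord n _))
    rw [coeff_eq_of_le_order_sub this hd]
    simp only [map_sum, map_smul, coeff_smul_field, Module.End.mul_apply]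
  -- The double sum over `n, m < N` reduces to the triangle `n + m < N`.
  have h3 : ∀ n m, N ≤ n + m → ((((n + 1).factorial : k)⁻¹ * bernoulliCoeff k m) •
      coeff d ((S n * (a - b) ^ m) Z)) = 0 := fun n m hnm => by
    rw [coeff_of_lt_order, smul_zero]
    rw [Module.End.mul_apply]
    refine lt_of_lt_of_le ?_ ((add_le_add_left ((ha.sub hb).pow m Z) _).trans (hSord n _))
    refine lt_of_lt_of_le ?_ (add_le_add_left (le_add_self) _)
    exact_mod_cast (by omega : d.degree < m + n)
  rw [h1]
  simp_rw [h2, Finset.smul_sum, smul_smul]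
  rw [sum_range_sum_range_eq_sum_antidiagonal N _ h3, map_sum]
  refine Finset.sum_congr rfl fun q _ => ?_
  rw [← LinearMap.smul_apply, ← sum_bernoulliCoeff_mul_geom_sum k hcomm q, LinearMap.sum_apply,
    map_sum]
  rfl

/-- If `θ F = (A / (e ^ A - 1)) Z` with `A = ad F`, then `e ^ F` solves `θ E = Z * E`. -/
theorem euler_expSeries_left [CharZero k] (i : Fin 2) {F Z : Series k}
    (hF : F.constantCoeff = 0)
    (hθ : ∀ N : ℕ, (N : ℕ∞) ≤ (euler k i F - ∑ m ∈ Finset.range N, bernoulliCoeff k m •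
      ((LinearMap.mulLeft k F - LinearMap.mulRight k F) ^ m) Z).order) :
    euler k i (expSeries F) = Z * expSeries F := by
  ext d
  rw [coeff_euler_expSeries i hF (Or.inl ⟨rfl, rfl⟩) hθ (Nat.lt_succ_self _)]
  refine (coeff_eq_of_le_order_sub ?_ (Nat.lt_succ_self _)).symm
  simp only [LinearMap.pow_mulRight, LinearMap.mulRight_apply, ← mul_smul_comm, ← Finset.mul_sum,
    ← mul_sub]
  exact (le_order_expSeries_sub hF _).trans (le_add_self.trans le_order_mul)

/-- If `θ F = (A / (e ^ A - 1)) Z` with `A = -ad F`, then `e ^ F` solves `θ E = E * Z`. -/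
theorem euler_expSeries_right [CharZero k] (i : Fin 2) {F Z : Series k}
    (hF : F.constantCoeff = 0)
    (hθ : ∀ N : ℕ, (N : ℕ∞) ≤ (euler k i F - ∑ m ∈ Finset.range N, bernoulliCoeff k m •
      ((LinearMap.mulRight k F - LinearMap.mulLeft k F) ^ m) Z).order) :
    euler k i (expSeries F) = expSeries F * Z := by
  ext d
  rw [coeff_euler_expSeries i hF (Or.inr ⟨rfl, rfl⟩) hθ (Nat.lt_succ_self _)]
  refine (coeff_eq_of_le_order_sub ?_ (Nat.lt_succ_self _)).symm
  simp only [LinearMap.pow_mulLeft, LinearMap.mulLeft_apply, ← smul_mul_assoc, ← Finset.sum_mul,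
    ← sub_mul]
  exact (le_order_expSeries_sub hF _).trans (le_self_add.trans le_order_mul)

/-- If `F` commutes with `θ F`, then `θ (e ^ F) = θ F * e ^ F`. -/
theorem euler_expSeries_of_commute [CharZero k] (i : Fin 2) {F : Series k}
    (hF : F.constantCoeff = 0) (h : Commute F (euler k i F)) :
    euler k i (expSeries F) = euler k i F * expSeries F := by
  refine euler_expSeries_left i hF fun N => ?_
  rcases N with _ | N
  · simp
  · rw [Finset.sum_range_succ', Finset.sum_eq_zero]
    · simp [bernoulliCoeff_zero]
    · intro m _
      rw [pow_succ, Module.End.mul_apply, LinearMap.sub_apply, LinearMap.mulLeft_apply,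
        LinearMap.mulRight_apply, h.eq, sub_self, map_zero, smul_zero]

theorem commute_expSeries {F Z : Series k} (hF : F.constantCoeff = 0) (h : Commute Z F) :
    Commute Z (expSeries F) := by
  refine ext fun d => ?_
  have hN := le_order_expSeries_sub hF (d.degree + 1)
  set T := ∑ n ∈ Finset.range (d.degree + 1), (n.factorial : k)⁻¹ • F ^ n
  have hT : Commute Z T := Commute.sum_right _ _ _ fun n _ => (h.pow_right n).smul_right _
  rw [coeff_eq_of_le_order_sub (f := Z * expSeries F) (g := Z * T) ?_ (Nat.lt_succ_self _),
    hT.eq, coeff_eq_of_le_order_sub (f := expSeries F * Z) (g := T * Z) ?_ (Nat.lt_succ_self _)]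
  · rw [← sub_mul]
    exact hN.trans (le_self_add.trans le_order_mul)
  · rw [← mul_sub]
    exact hN.trans (le_add_self.trans le_order_mul)

/-- The exponential is injective on the series without constant term. -/
theorem expSeries_injective {F G : Series k} (hF : F.constantCoeff = 0)
    (hG : G.constantCoeff = 0) (h : expSeries F = expSeries G) : F = G := by
  -- If `F - G` has order at least `N`, then `F ^ n - G ^ n` has order at least `N + 1` for
  -- `n ≥ 2`, and comparing the terms of degree `N` in the exponentials gives the next step.
  have key : ∀ N : ℕ, (N : ℕ∞) ≤ (F - G).order := fun N => by
    induction N with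
    | zero => simp
    | succ N ih =>
      have hp : ∀ n, ((N + 1 : ℕ) : ℕ∞) ≤ (F ^ (n + 2) - G ^ (n + 2)).order := by
        have hstep : ∀ n, F ^ (n + 1) - G ^ (n + 1) =
            F ^ n * (F - G) + (F ^ n - G ^ n) * G := fun n => by
          rw [pow_succ, pow_succ]; noncomm_ring
        have h1 : ∀ n, (N : ℕ∞) ≤ (F ^ n - G ^ n).order := fun n => by
          induction n with
          | zero => simp
          | succ n ihn =>
            rw [hstep]
            refine le_trans (le_min ?_ ?_) min_order_le_add
            · exact ih.trans (le_add_self.trans le_order_mul)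
            · exact ihn.trans (le_self_add.trans le_order_mul)
        intro n
        rw [hstep (n + 1), Nat.cast_succ]
        refine le_trans (le_min ?_ ?_) min_order_le_add
        · refine le_trans ?_ le_order_mul
          rw [add_comm]
          refine add_le_add (le_trans ?_ (natCast_le_order_pow hF (n + 1))) ih
          exact_mod_cast Nat.succ_pos n
        · exact (add_le_add (h1 _) (constantCoeff_eq_zero_iff_one_le_order.1 hG)).trans
            le_order_mul
      refine nat_le_order fun d hd => ?_
      have hc := congrArg (coeff d) h
      rw [coeff_expSeries hF (show d.degree < N + 2 by omega),
        coeff_expSeries hG (show d.degree < N + 2 by omega), Finset.sum_range_succ',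
        Finset.sum_range_succ', Finset.sum_range_succ', Finset.sum_range_succ'] at hc
      have ht : ∀ n, coeff d (F ^ (n + 1 + 1)) = coeff d (G ^ (n + 1 + 1)) := fun n =>
        coeff_eq_of_le_order_sub (hp n) hd
      simp only [ht, pow_zero, add_left_inj, add_right_inj] at hc
      rw [map_sub, sub_eq_zero]
      simpa using hc
  rw [← sub_eq_zero, ← order_eq_top_iff]
  exact ENat.eq_top_iff_forall_ge.2 key

/-- A first order linear differential equation has at most one solution with a given
restriction to the line where the `i`-th variable is zero. -/
theorem eq_of_euler_eq_left [CharZero k] (i : Fin 2) {Z E E' : Series k}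
    (hZ : Z.constantCoeff = 0) (h : euler k i E = Z * E) (h' : euler k i E' = Z * E')
    (h0 : ∀ d : Fin 2 →₀ ℕ, d i = 0 → coeff d E = coeff d E') : E = E' := by
  have key : ∀ N : ℕ, (N : ℕ∞) ≤ (E - E').order := fun N => by
    induction N with
    | zero => simp
    | succ N ih =>
      refine nat_le_order fun d hd => ?_
      by_cases hi : d i = 0
      · rw [map_sub, h0 d hi, sub_self]
      · have h1 : (d i : k) • coeff d (E - E') = 0 := by
          rw [← coeff_euler, map_sub, h, h', ← mul_sub]
          refine coeff_of_lt_order (lt_of_lt_of_le ?_ le_order_mul)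
          refine lt_of_lt_of_le ?_
            (add_le_add (constantCoeff_eq_zero_iff_one_le_order.1 hZ) ih)
          exact_mod_cast (by omega : d.degree < 1 + N)
        exact (smul_eq_zero.1 h1).resolve_left (Nat.cast_ne_zero.2 hi)
  rw [← sub_eq_zero, ← order_eq_top_iff]
  exact ENat.eq_top_iff_forall_ge.2 key

theorem eq_of_euler_eq_right [CharZero k] (i : Fin 2) {Z E E' : Series k}
    (hZ : Z.constantCoeff = 0) (h : euler k i E = E * Z) (h' : euler k i E' = E' * Z)
    (h0 : ∀ d : Fin 2 →₀ ℕ, d i = 0 → coeff d E = coeff d E') : E = E' := by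
  have key : ∀ N : ℕ, (N : ℕ∞) ≤ (E - E').order := fun N => by
    induction N with
    | zero => simp
    | succ N ih =>
      refine nat_le_order fun d hd => ?_
      by_cases hi : d i = 0
      · rw [map_sub, h0 d hi, sub_self]
      · have h1 : (d i : k) • coeff d (E - E') = 0 := by
          rw [← coeff_euler, map_sub, h, h', ← sub_mul]
          refine coeff_of_lt_order (lt_of_lt_of_le ?_ le_order_mul)
          refine lt_of_lt_of_le ?_
            (add_le_add ih (constantCoeff_eq_zero_iff_one_le_order.1 hZ))
          exact_mod_cast (by omega : d.degree < N + 1)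
        exact (smul_eq_zero.1 h1).resolve_left (Nat.cast_ne_zero.2 hi)
  rw [← sub_eq_zero, ← order_eq_top_iff]
  exact ENat.eq_top_iff_forall_ge.2 key

end Series

/-! ### The free Lie algebra embeds into the free associative algebra -/

section Embedding

variable {k : Type u} [Field k]

/-- The action of the free Lie algebra `L` on `L × k` for which a generator `X` acts by
`(Q, c) ↦ ([X, Q] + c X, 0)`. -/
noncomputable def affineAction (k : Type u) [Field k] (i : Fin 2) :
    Module.End k (FreeLieAlgebra k (Fin 2) × k) :=
  LinearMap.prod
    (((LieAlgebra.ad k _ (FreeLieAlgebra.of k i)).comp (LinearMap.fst k _ k)) +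
      (LinearMap.toSpanSingleton k _ (FreeLieAlgebra.of k i)).comp (LinearMap.snd k _ k)) 0

theorem affineAction_apply (i : Fin 2) (v : FreeLieAlgebra k (Fin 2) × k) :
    affineAction k i v = (⁅FreeLieAlgebra.of k i, v.1⁆ + v.2 • FreeLieAlgebra.of k i, 0) := rfl

/-- A Lie monomial `m` of bidegree `(w, b)` acts by `(Q, c) ↦ ([m, Q] + c (w + b) m, 0)`. -/
theorem lift_affineAction_monomial {w b : ℕ} {m : FreeLieAlgebra k (Fin 2)}
    (hm : IsLieMonomial k w b m) (v : FreeLieAlgebra k (Fin 2) × k) :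
    FreeLieAlgebra.lift k (affineAction k) m v = (⁅m, v.1⁆ + (v.2 * (w + b)) • m, 0) := by
  induction hm generalizing v with
  | X => simp [affineAction_apply]
  | Y => simp [affineAction_apply]
  | @lie w b w' b' m m' _ _ ih ih' =>
    rw [LieHom.map_lie, LieRing.of_associative_ring_bracket, LinearMap.sub_apply,
      Module.End.mul_apply, Module.End.mul_apply, ih, ih', ih, ih']
    ext
    · simp only [lie_add, lie_smul, zero_mul, zero_smul, add_zero, Prod.fst_sub, lie_lie,
        ← lie_skew m' m, Nat.cast_add]
      module
    · simp

theorem lift_affineAction_bihomogeneous {w b : ℕ} {P : FreeLieAlgebra k (Fin 2)}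
    (hP : P ∈ bihomogeneous k w b) :
    FreeLieAlgebra.lift k (affineAction k) P (0, 1) = (((w : k) + b) • P, 0) := by
  induction hP using Submodule.span_induction with
  | mem m hm => rw [lift_affineAction_monomial hm]; simp
  | zero => simp [← Prod.zero_eq_mk]
  | add P Q _ _ hP hQ => rw [map_add, LinearMap.add_apply, hP, hQ]; simp
  | smul r P _ hP => rw [map_smul, LinearMap.smul_apply, hP, smul_comm]; simp

theorem bihomogeneous_zero_zero {P : FreeLieAlgebra k (Fin 2)}
    (hP : P ∈ bihomogeneous k 0 0) : P = 0 := by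
  have hpos : ∀ {w b : ℕ} {m : FreeLieAlgebra k (Fin 2)}, IsLieMonomial k w b m → 0 < w + b := by
    intro w b m h
    induction h <;> omega
  have : {m | IsLieMonomial k 0 0 m} = ∅ :=
    Set.eq_empty_of_forall_notMem fun m hm => lt_irrefl _ (hpos hm)
  rwa [bihomogeneous, this, Submodule.span_empty, Submodule.mem_bot] at hP

/-- The action on `L × k` extends to the free associative algebra, and a Lie polynomial `P` of
bidegree `(w, b)` sends `(0, 1)` to `((w + b) P, 0)`; so `P` is determined by its image in the
free associative algebra. -/
theorem eq_zero_of_toAssoc_eq_zero [CharZero k] {w b : ℕ} {P : FreeLieAlgebra k (Fin 2)}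
    (hP : P ∈ bihomogeneous k w b) (h : toAssoc k P = 0) : P = 0 := by
  have hfac : FreeLieAlgebra.lift k (affineAction k) =
      ((FreeAlgebra.lift k (affineAction k) : FreeAlgebra k (Fin 2) →ₐ[k] _) : _ →ₗ⁅k⁆ _).comp
        (toAssoc k) := by
    refine FreeLieAlgebra.hom_ext fun i => ?_
    simp [toAssoc]
  have h1 := lift_affineAction_bihomogeneous hP
  rw [hfac, LieHom.comp_apply, h, map_zero, LinearMap.zero_apply] at h1
  have h2 : ((w : k) + b) • P = 0 := (congrArg Prod.fst h1).symm
  rcases smul_eq_zero.1 h2 with h3 | h3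
  · have h4 : w + b = 0 := by exact_mod_cast h3
    obtain ⟨rfl, rfl⟩ : w = 0 ∧ b = 0 := by omega
    exact bihomogeneous_zero_zero hP
  · exact h3

theorem lie_mem_bihomogeneous {w b w' b' : ℕ} {P Q : FreeLieAlgebra k (Fin 2)}
    (hP : P ∈ bihomogeneous k w b) (hQ : Q ∈ bihomogeneous k w' b') :
    ⁅P, Q⁆ ∈ bihomogeneous k (w + w') (b + b') := by
  induction hP using Submodule.span_induction with
  | mem m hm =>
    induction hQ using Submodule.span_induction with
    | mem m' hm' => exact Submodule.subset_span (hm.lie hm')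
    | zero => simp
    | add Q Q' _ _ h h' => rw [lie_add]; exact add_mem h h'
    | smul r Q _ h => rw [lie_smul]; exact Submodule.smul_mem _ _ h
  | zero => simp
  | add P P' _ _ h h' => rw [add_lie]; exact add_mem h h'
  | smul r P _ h => rw [smul_lie]; exact Submodule.smul_mem _ _ h

end Embedding

/-! ### Bernoulli sums as iterated convolutions -/

section Convolution

open Finset.HasAntidiagonal (antidiagonal)

variable {k : Type u} [Field k] {L : Type v} [LieRing L]

/-- The bracket of two bigraded families. -/
def conv (K G : ℕ → ℕ → L) (w b : ℕ) : L :=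
  ∑ p ∈ antidiagonal w, ∑ q ∈ antidiagonal b, ⁅K p.1 q.1, G p.2 q.2⁆

/-- The family with only component `z` in bidegree `(0, 0)`. -/
def atOrigin (z : L) (w b : ℕ) : L :=
  if w = 0 ∧ b = 0 then z else 0

/-- The family `K` with its component of bidegree `(0, 0)` replaced by zero. -/
def dropOrigin (K : ℕ → ℕ → L) (w b : ℕ) : L :=
  if (w, b) = (0, 0) then 0 else K w b

/-- The component of bidegree `(w, b)` of the `n`-fold bracket `[K, [K, …, [K, z] … ]]`. -/
def nested (K : ℕ → ℕ → L) (z : L) (n : ℕ) : ℕ → ℕ → L :=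
  (conv K)^[n] (atOrigin z)

theorem nested_zero (K : ℕ → ℕ → L) (z : L) : nested K z 0 = atOrigin z := rfl

theorem nested_succ (K : ℕ → ℕ → L) (z : L) (n : ℕ) :
    nested K z (n + 1) = conv K (nested K z n) :=
  Function.iterate_succ_apply' _ _ _

theorem dropOrigin_eq_self {K : ℕ → ℕ → L} (h : K 0 0 = 0) : dropOrigin K = K := by
  funext w b
  rw [dropOrigin]
  split_ifs with hwb
  · obtain ⟨rfl, rfl⟩ := Prod.mk.inj hwb
    exact h.symm
  · rfl

theorem sum_antidiagonalTuple_succ {M : Type*} [AddCommMonoid M] (n w : ℕ)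
    (f : (Fin (n + 1) → ℕ) → M) :
    ∑ ws ∈ Finset.Nat.antidiagonalTuple (n + 1) w, f ws =
      ∑ p ∈ antidiagonal w, ∑ vs ∈ Finset.Nat.antidiagonalTuple n p.2, f (Fin.cons p.1 vs) := by
  rw [Finset.sum_sigma']
  refine Finset.sum_bij' (fun ws _ => ⟨(ws 0, ∑ i, Fin.tail ws i), Fin.tail ws⟩)
    (fun x _ => Fin.cons x.1.1 x.2) ?_ ?_ ?_ ?_ ?_
  · intro ws h
    rw [Finset.Nat.mem_antidiagonalTuple, Fin.sum_univ_succ] at h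
    simpa [Finset.Nat.mem_antidiagonalTuple, Fin.tail] using h
  · rintro ⟨⟨a, c⟩, vs⟩ h
    simp only [Finset.mem_sigma, Finset.HasAntidiagonal.mem_antidiagonal,
      Finset.Nat.mem_antidiagonalTuple] at h
    rw [Finset.Nat.mem_antidiagonalTuple, Fin.sum_univ_succ]
    simp [h.1, h.2]
  · intro ws _
    exact Fin.cons_self_tail ws
  · rintro ⟨⟨a, c⟩, vs⟩ h
    simp only [Finset.mem_sigma, Finset.HasAntidiagonal.mem_antidiagonal,
      Finset.Nat.mem_antidiagonalTuple] at h
    simp [h.2]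
  · intro ws _
    rw [Fin.cons_self_tail]

theorem sum_foldr_eq_nested (K : ℕ → ℕ → L) (z : L) (n w b : ℕ) :
    ∑ ws ∈ Finset.Nat.antidiagonalTuple n w, ∑ bs ∈ Finset.Nat.antidiagonalTuple n b,
      (List.ofFn fun i => K (ws i) (bs i)).foldr (fun a c => ⁅a, c⁆) z = nested K z n w b := by
  induction n generalizing w b with
  | zero =>
    rcases w with _ | w <;> rcases b with _ | b <;> simp [nested_zero, atOrigin]
  | succ n ih =>
    rw [nested_succ, conv, sum_antidiagonalTuple_succ]
    refine Finset.sum_congr rfl fun p _ => ?_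
    simp_rw [sum_antidiagonalTuple_succ, List.ofFn_succ, List.foldr_cons, Fin.cons_zero,
      Fin.cons_succ, ← ih, ← lie_sum]
    rw [Finset.sum_comm]
    simp_rw [lie_sum]

/-- This makes the restriction to nonzero pairs in `bernoulliSum` equivalent to replacing the
component of bidegree `(0, 0)` by zero. -/
theorem foldr_eq_zero_of_mem {l : List L} (z : L) (h : (0 : L) ∈ l) :
    l.foldr (fun a c => ⁅a, c⁆) z = 0 := by
  induction l with
  | nil => simp at h
  | cons a l ih =>
    rcases List.mem_cons.1 h with h | h
    · simp [← h]
    · simp [ih h]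

theorem bernoulliSum_eq_sum_nested [LieAlgebra k L] (K : ℕ → ℕ → L) (z : L) (w b : ℕ) :
    bernoulliSum k K z w b = ∑ r ∈ Finset.range ((w + b) / 2 + 1),
      bernoulliCoeff k (2 * r) • nested (dropOrigin K) z (2 * r) w b := by
  refine Finset.sum_congr rfl fun r _ => ?_
  rw [← sum_foldr_eq_nested, bernoulliCoeff]
  congr 1
  refine Finset.sum_congr rfl fun ws _ => ?_
  rw [Finset.sum_filter]
  refine Finset.sum_congr rfl fun bs _ => ?_
  split_ifs with h
  · congr 2
    funext i
    rw [dropOrigin, if_neg (h i)]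
  · obtain ⟨i, hi⟩ := not_forall.1 h
    refine (foldr_eq_zero_of_mem z (List.mem_ofFn.2 ⟨i, ?_⟩)).symm
    rw [dropOrigin, if_pos (not_not.1 hi)]

theorem nested_congr {K K' : ℕ → ℕ → L} (z : L) (n : ℕ) {w b : ℕ}
    (h : ∀ w' b', w' ≤ w → b' ≤ b → K w' b' = K' w' b') :
    nested K z n w b = nested K' z n w b := by
  induction n generalizing w b with
  | zero => rfl
  | succ n ih =>
    rw [nested_succ, nested_succ, conv, conv]
    refine Finset.sum_congr rfl fun p hp => Finset.sum_congr rfl fun q hq => ?_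
    rw [Finset.HasAntidiagonal.mem_antidiagonal] at hp hq
    rw [h _ _ (by omega) (by omega), ih fun w' b' hw hb => h w' b' (by omega) (by omega)]

theorem bernoulliSum_congr [LieAlgebra k L] {K K' : ℕ → ℕ → L} (z : L) {w b : ℕ}
    (h : ∀ w' b', w' ≤ w → b' ≤ b → (w', b') ≠ (0, 0) → K w' b' = K' w' b') :
    bernoulliSum k K z w b = bernoulliSum k K' z w b := by
  rw [bernoulliSum_eq_sum_nested, bernoulliSum_eq_sum_nested]
  refine Finset.sum_congr rfl fun r _ => ?_
  rw [nested_congr z]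
  intro w' b' hw hb
  rw [dropOrigin, dropOrigin]
  split_ifs with h0
  exacts [rfl, h w' b' hw hb h0]

theorem map_nested [LieAlgebra k L] {L' : Type*} [LieRing L'] [LieAlgebra k L'] (φ : L →ₗ⁅k⁆ L')
    (K : ℕ → ℕ → L) (z : L) (n w b : ℕ) :
    φ (nested K z n w b) = nested (fun w b => φ (K w b)) (φ z) n w b := by
  induction n generalizing w b with
  | zero => rw [nested_zero, nested_zero, atOrigin, atOrigin]; split_ifs <;> simp
  | succ n ih => simp only [nested_succ, conv, map_sum, LieHom.map_lie, ih]

theorem map_bernoulliSum [LieAlgebra k L] {L' : Type*} [LieRing L'] [LieAlgebra k L']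
    (φ : L →ₗ⁅k⁆ L') (K : ℕ → ℕ → L) (z : L) (w b : ℕ) :
    φ (bernoulliSum k K z w b) = bernoulliSum k (fun w b => φ (K w b)) (φ z) w b := by
  have : (fun w b => φ (dropOrigin K w b)) = dropOrigin fun w b => φ (K w b) := by
    funext w b
    rw [dropOrigin, dropOrigin]
    split_ifs <;> simp
  simp only [bernoulliSum_eq_sum_nested, map_sum, map_smul, map_nested, this]

/-- Every bracket with `K` raises the total degree. -/
theorem nested_eq_zero {K : ℕ → ℕ → L} (hK : K 0 0 = 0) (z : L) {n w b : ℕ} (h : w + b < n) :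
    nested K z n w b = 0 := by
  induction n generalizing w b with
  | zero => omega
  | succ n ih =>
    rw [nested_succ, conv]
    refine Finset.sum_eq_zero fun p hp => Finset.sum_eq_zero fun q hq => ?_
    rw [Finset.HasAntidiagonal.mem_antidiagonal] at hp hq
    by_cases h0 : p.1 = 0 ∧ q.1 = 0
    · rw [h0.1, h0.2, hK, zero_lie]
    · rw [ih (by omega), lie_zero]

theorem nested_one (K : ℕ → ℕ → L) (z : L) (w b : ℕ) : nested K z 1 w b = ⁅K w b, z⁆ := by
  rw [nested_succ, nested_zero, conv,
    Finset.sum_eq_single_of_mem (w, 0) (by simp), Finset.sum_eq_single_of_mem (b, 0) (by simp)]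
  · simp [atOrigin]
  · intro q hq hne
    have : q.2 ≠ 0 := fun h0 => hne (by
      rw [Finset.HasAntidiagonal.mem_antidiagonal] at hq
      exact Prod.ext (by simpa [h0] using hq) h0)
    simp [atOrigin, this]
  · intro p hp hne
    have : p.2 ≠ 0 := fun h0 => hne (by
      rw [Finset.HasAntidiagonal.mem_antidiagonal] at hp
      exact Prod.ext (by simpa [h0] using hp) h0)
    simp [atOrigin, this]

/-- Let `ε` be a sign and `A = ε * ad K`. The linear term `-1/2 A z` together with the Bernoulli
sum is the series `A / (e ^ A - 1)` applied to `z`, as the other odd Bernoulli numbers vanish. -/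
theorem sum_bernoulliCoeff_nested [CharZero k] [LieAlgebra k L] {K : ℕ → ℕ → L}
    (hK : K 0 0 = 0) (z : L) {ε : k} (hε : ε ^ 2 = 1) {w b N : ℕ} (hN : w + b < N) :
    ∑ m ∈ Finset.range N, bernoulliCoeff k m • ε ^ m • nested K z m w b =
      (ε * (1 / 2)) • ⁅z, K w b⁆ + bernoulliSum k K z w b := by
  have htrunc : ∀ M, w + b < M →
      ∑ m ∈ Finset.range M, bernoulliCoeff k m • ε ^ m • nested K z m w b =
        ∑ m ∈ Finset.range (w + b + 1),
          bernoulliCoeff k m • ε ^ m • nested K z m w b := fun M hM => by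
    refine (Finset.sum_subset (Finset.range_subset_range.2 hM) fun m _ hm => ?_).symm
    rw [Finset.mem_range] at hm
    rw [nested_eq_zero hK z (by omega), smul_zero, smul_zero]
  have heo : ∀ (M : ℕ) (f : ℕ → L), ∑ m ∈ Finset.range (2 * M), f m =
      ∑ r ∈ Finset.range M, f (2 * r + 1) + ∑ r ∈ Finset.range M, f (2 * r) := fun M f => by
    induction M with
    | zero => simp
    | succ M ih =>
      rw [show 2 * (M + 1) = 2 * M + 1 + 1 by ring, Finset.sum_range_succ, Finset.sum_range_succ,
        ih, Finset.sum_range_succ, Finset.sum_range_succ]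
      abel
  rw [htrunc N hN, ← htrunc (2 * ((w + b) / 2 + 1)) (by omega), heo, bernoulliSum_eq_sum_nested,
    dropOrigin_eq_self hK]
  congr 1
  · rw [Finset.sum_range_succ', Finset.sum_eq_zero, zero_add, mul_zero, zero_add, nested_one,
      bernoulliCoeff_one, neg_smul, pow_one, ← smul_neg, ← smul_neg, lie_skew, smul_smul, mul_comm]
    intro r _
    rw [bernoulliCoeff_odd k ⟨r + 1, rfl⟩ (by omega), zero_smul]
  · simp_rw [pow_mul, hε, one_pow, one_smul]

end Convolution

/-! ### Solving the recursions -/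

section Solutions

variable {k : Type u} [Field k] {L : Type v} [LieRing L] [LieAlgebra k L]

theorem WRecursion.eq [CharZero k] {x y : L} {K K' : ℕ → ℕ → L}
    (hr : WRecursion k x K) (hK : WInitial x y K) (hK' : WInitial x y K')
    (hr' : WRecursion k x K') (w b : ℕ) (h : (w, b) ≠ (0, 0)) : K w b = K' w b := by
  induction w using Nat.strong_induction_on generalizing b with
  | _ w ih =>
    rcases w with _ | w
    · match b with
      | 0 => exact absurd rfl h
      | 1 => rw [hK.2.1, hK'.2.1]
      | b + 2 => rw [hK.2.2 _ (by omega), hK'.2.2 _ (by omega)]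
    · by_cases h0 : (w, b) = (0, 0)
      · obtain ⟨rfl, rfl⟩ := Prod.mk.inj h0
        rw [hK.1, hK'.1]
      · have hw : (w : k) + 1 ≠ 0 := Nat.cast_add_one_ne_zero w
        refine smul_right_injective L hw ?_
        simp only [hr w b h0, hr' w b h0]
        rw [ih w (by omega) b h0,
          bernoulliSum_congr x fun w' b' hw' _ h' => ih w' (by omega) b' h']

theorem BRecursion.eq [CharZero k] {x y : L} {K K' : ℕ → ℕ → L}
    (hr : BRecursion k y K) (hK : BInitial x y K) (hK' : BInitial x y K')
    (hr' : BRecursion k y K') (w b : ℕ) (h : (w, b) ≠ (0, 0)) : K w b = K' w b := by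
  induction b using Nat.strong_induction_on generalizing w with
  | _ b ih =>
    rcases b with _ | b
    · match w with
      | 0 => exact absurd rfl h
      | 1 => rw [hK.2.1, hK'.2.1]
      | w + 2 => rw [hK.2.2 _ (by omega), hK'.2.2 _ (by omega)]
    · by_cases h0 : (w, b) = (0, 0)
      · obtain ⟨rfl, rfl⟩ := Prod.mk.inj h0
        rw [hK.1, hK'.1]
      · have hb : (b : k) + 1 ≠ 0 := Nat.cast_add_one_ne_zero b
        refine smul_right_injective L hb ?_
        simp only [hr w b h0, hr' w b h0]
        rw [ih b (by omega) w h0,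
          bernoulliSum_congr y fun w' b' _ hb' h' => ih b' (by omega) w' h']

variable (k)

/-- The solution of the `w`-recursion, computed by recursion on `w`. The Bernoulli sum at `(w, b)`
only involves terms with `w' ≤ w`; replacing the others by zero makes the recursion
well-founded. -/
noncomputable def wSolution (x y : L) : ℕ → ℕ → L
  | 0, b => if b = 1 then y else 0
  | w + 1, b => if (w, b) = (0, 0) then x else
      ((w : k) + 1)⁻¹ • ((1 / 2 : k) • ⁅x, wSolution x y w b⁆ +
        bernoulliSum k (fun w' b' => if _h : w' ≤ w then wSolution x y w' b' else 0) x w b)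
termination_by w => w

/-- The solution of the `b`-recursion, computed by recursion on `b`. The Bernoulli sum at `(w, b)`
only involves terms with `b' ≤ b`; replacing the others by zero makes the recursion
well-founded. -/
noncomputable def bSolution (x y : L) : ℕ → ℕ → L
  | w, 0 => if w = 1 then x else 0
  | w, b + 1 => if (w, b) = (0, 0) then y else
      ((b : k) + 1)⁻¹ • (-(1 / 2 : k) • ⁅y, bSolution x y w b⁆ +
        bernoulliSum k (fun w' b' => if _h : b' ≤ b then bSolution x y w' b' else 0) y w b)
termination_by _ b => b

variable {k}

theorem wInitial_wSolution (x y : L) : WInitial x y (wSolution k x y) := by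
  refine ⟨?_, ?_, fun b hb => ?_⟩
  · simp [wSolution]
  · simp [wSolution]
  · rw [wSolution, if_neg (by omega)]

theorem bInitial_bSolution (x y : L) : BInitial x y (bSolution k x y) := by
  refine ⟨?_, ?_, fun w hw => ?_⟩
  · simp [bSolution]
  · simp [bSolution]
  · rw [bSolution, if_neg (by omega)]

theorem wSolution_zero_zero (x y : L) : wSolution k x y 0 0 = 0 := by simp [wSolution]

theorem bSolution_zero_zero (x y : L) : bSolution k x y 0 0 = 0 := by simp [bSolution]

theorem wRecursion_wSolution [CharZero k] (x y : L) : WRecursion k x (wSolution k x y) := by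
  intro w b h
  rw [wSolution, if_neg h, smul_inv_smul₀ (Nat.cast_add_one_ne_zero w)]
  congr 1
  exact bernoulliSum_congr x fun w' b' hw _ _ => dif_pos hw

theorem bRecursion_bSolution [CharZero k] (x y : L) : BRecursion k y (bSolution k x y) := by
  intro w b h
  rw [bSolution, if_neg h, smul_inv_smul₀ (Nat.cast_add_one_ne_zero b)]
  congr 1
  exact bernoulliSum_congr y fun w' b' _ hb _ => dif_pos hb

end Solutions

/-! ### Bidegrees of the solutions in the free Lie algebra -/

section Bihomogeneous

variable {k : Type u} [Field k]

local notation "𝕃" => FreeLieAlgebra k (Fin 2)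

theorem nested_mem_bihomogeneous {K : ℕ → ℕ → 𝕃} {z : 𝕃} {w₀ b₀ : ℕ}
    (hz : z ∈ bihomogeneous k w₀ b₀) (n : ℕ) {w b : ℕ}
    (hK : ∀ w' b', w' ≤ w → b' ≤ b → K w' b' ∈ bihomogeneous k w' b') :
    nested K z n w b ∈ bihomogeneous k (w + w₀) (b + b₀) := by
  induction n generalizing w b with
  | zero =>
    rw [nested_zero, atOrigin]
    split_ifs with h
    · rwa [h.1, h.2, zero_add, zero_add]
    · exact zero_mem _
  | succ n ih =>
    rw [nested_succ, conv]
    refine sum_mem fun p hp => sum_mem fun q hq => ?_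
    rw [Finset.HasAntidiagonal.mem_antidiagonal] at hp hq
    rw [← hp, ← hq, add_assoc, add_assoc]
    exact lie_mem_bihomogeneous (hK _ _ (by omega) (by omega))
      (ih fun w' b' hw hb => hK w' b' (by omega) (by omega))

theorem bernoulliSum_mem_bihomogeneous {K : ℕ → ℕ → 𝕃} {z : 𝕃} {w₀ b₀ : ℕ}
    (hz : z ∈ bihomogeneous k w₀ b₀) {w b : ℕ}
    (hK : ∀ w' b', w' ≤ w → b' ≤ b → K w' b' ∈ bihomogeneous k w' b') :
    bernoulliSum k K z w b ∈ bihomogeneous k (w + w₀) (b + b₀) := by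
  rw [bernoulliSum_eq_sum_nested]
  refine sum_mem fun r _ => Submodule.smul_mem _ _ (nested_mem_bihomogeneous hz _ ?_)
  intro w' b' hw hb
  rw [dropOrigin]
  split_ifs
  exacts [zero_mem _, hK w' b' hw hb]

theorem of_zero_mem_bihomogeneous : FreeLieAlgebra.of k (0 : Fin 2) ∈ bihomogeneous k 1 0 :=
  Submodule.subset_span .X

theorem of_one_mem_bihomogeneous : FreeLieAlgebra.of k (1 : Fin 2) ∈ bihomogeneous k 0 1 :=
  Submodule.subset_span .Y

theorem wSolution_mem_bihomogeneous (w b : ℕ) :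
    wSolution k (FreeLieAlgebra.of k (0 : Fin 2)) (FreeLieAlgebra.of k 1) w b ∈
      bihomogeneous k w b := by
  induction w using Nat.strong_induction_on generalizing b with
  | _ w ih =>
    rcases w with _ | w
    · rw [wSolution]
      split_ifs with h
      · subst h; exact of_one_mem_bihomogeneous
      · exact zero_mem _
    · rw [wSolution]
      split_ifs with h
      · obtain ⟨rfl, rfl⟩ := Prod.mk.inj h
        exact of_zero_mem_bihomogeneous
      · refine Submodule.smul_mem _ _ (add_mem (Submodule.smul_mem _ _ ?_) ?_)
        · have := lie_mem_bihomogeneous of_zero_mem_bihomogeneous (ih w (by omega) b)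
          rwa [add_comm 1 w, zero_add] at this
        · refine bernoulliSum_mem_bihomogeneous of_zero_mem_bihomogeneous fun w' b' hw _ => ?_
          rw [dif_pos hw]
          exact ih w' (by omega) b'

theorem bSolution_mem_bihomogeneous (w b : ℕ) :
    bSolution k (FreeLieAlgebra.of k (0 : Fin 2)) (FreeLieAlgebra.of k 1) w b ∈
      bihomogeneous k w b := by
  induction b using Nat.strong_induction_on generalizing w with
  | _ b ih =>
    rcases b with _ | b
    · rw [bSolution]
      split_ifs with h
      · subst h; exact of_zero_mem_bihomogeneous
      · exact zero_mem _
    · rw [bSolution]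
      split_ifs with h
      · obtain ⟨rfl, rfl⟩ := Prod.mk.inj h
        exact of_one_mem_bihomogeneous
      · refine Submodule.smul_mem _ _ (add_mem (Submodule.smul_mem _ _ ?_) ?_)
        · have := lie_mem_bihomogeneous of_one_mem_bihomogeneous (ih b (by omega) w)
          rwa [add_comm 1 b, zero_add] at this
        · refine bernoulliSum_mem_bihomogeneous of_one_mem_bihomogeneous fun w' b' _ hb => ?_
          rw [dif_pos hb]
          exact ih b' (by omega) w'

end Bihomogeneous

/-! ### The solutions of the recursions exponentiate to `exp X * exp Y` -/

section Exponentiate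

open MvPowerSeries
open Finset.HasAntidiagonal (antidiagonal mem_antidiagonal)

variable {k : Type u} [Field k]

/-- The power series in `s, t` whose coefficient at `s ^ w t ^ b` is the image of `K w b` in the
free associative algebra. -/
noncomputable def toSeries (K : ℕ → ℕ → FreeLieAlgebra k (Fin 2)) : Series k :=
  fun d => toAssoc k (K (d 0) (d 1))

theorem coeff_toSeries (K : ℕ → ℕ → FreeLieAlgebra k (Fin 2)) (d : Fin 2 →₀ ℕ) :
    coeff d (toSeries K) = toAssoc k (K (d 0) (d 1)) := rfl

theorem constantCoeff_toSeries {K : ℕ → ℕ → FreeLieAlgebra k (Fin 2)} (hK : K 0 0 = 0) :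
    (toSeries K).constantCoeff = 0 := by
  rw [← coeff_zero_eq_constantCoeff_apply, coeff_toSeries]
  simp [hK]

/-- The exponent vector of `s ^ w t ^ b`. -/
noncomputable def bidegree (w b : ℕ) : Fin 2 →₀ ℕ := Finsupp.single 0 w + Finsupp.single 1 b

@[simp] theorem bidegree_zero (w b : ℕ) : bidegree w b 0 = w := by simp [bidegree]

@[simp] theorem bidegree_one (w b : ℕ) : bidegree w b 1 = b := by simp [bidegree]

theorem degree_eq (d : Fin 2 →₀ ℕ) : d.degree = d 0 + d 1 := by
  rw [Finsupp.degree_eq_sum, Fin.sum_univ_two]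

theorem ext_fin_two {d e : Fin 2 →₀ ℕ} (h0 : d 0 = e 0) (h1 : d 1 = e 1) : d = e := by
  ext i
  fin_cases i
  exacts [h0, h1]

theorem sum_antidiagonal_bidegree {M : Type*} [AddCommMonoid M] (d : Fin 2 →₀ ℕ)
    (f : ℕ → ℕ → ℕ → ℕ → M) :
    ∑ p ∈ antidiagonal d, f (p.1 0) (p.1 1) (p.2 0) (p.2 1) =
      ∑ p ∈ antidiagonal (d 0), ∑ q ∈ antidiagonal (d 1), f p.1 q.1 p.2 q.2 := by
  rw [← Finset.sum_product']
  refine Finset.sum_bij' (fun p _ => ((p.1 0, p.2 0), (p.1 1, p.2 1)))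
    (fun x _ => (bidegree x.1.1 x.2.1, bidegree x.1.2 x.2.2)) ?_ ?_ ?_ ?_ ?_
  · intro p hp
    rw [mem_antidiagonal] at hp
    simp [← hp]
  · intro x hx
    rw [Finset.mem_product, mem_antidiagonal, mem_antidiagonal] at hx
    rw [mem_antidiagonal]
    exact ext_fin_two (by simp [hx.1]) (by simp [hx.2])
  · intro p _
    exact Prod.ext (ext_fin_two (by simp) (by simp)) (ext_fin_two (by simp) (by simp))
  · intro x _
    simp
  · intro p _
    rfl

theorem toSeries_conv (K G : ℕ → ℕ → FreeLieAlgebra k (Fin 2)) :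
    toSeries (conv K G) = toSeries K * toSeries G - toSeries G * toSeries K := by
  ext d
  have hswap : ∑ p ∈ antidiagonal d, coeff p.1 (toSeries G) * coeff p.2 (toSeries K) =
      ∑ p ∈ antidiagonal d, coeff p.2 (toSeries G) * coeff p.1 (toSeries K) := by
    conv_lhs => rw [← Finset.HasAntidiagonal.map_swap_antidiagonal, Finset.sum_map]
    rfl
  rw [map_sub, coeff_mul, coeff_mul, hswap, coeff_toSeries, conv, ← Finset.sum_sub_distrib]
  simp only [coeff_toSeries, map_sum, LieHom.map_lie,
    LieRing.of_associative_ring_bracket]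
  exact (sum_antidiagonal_bidegree d fun a b a' b' =>
    toAssoc k (K a b) * toAssoc k (G a' b') - toAssoc k (G a' b') * toAssoc k (K a b)).symm

theorem toSeries_nested (K : ℕ → ℕ → FreeLieAlgebra k (Fin 2)) (z : FreeLieAlgebra k (Fin 2))
    (n : ℕ) : toSeries (nested K z n) = ((LinearMap.mulLeft k (toSeries K) -
      LinearMap.mulRight k (toSeries K)) ^ n) (C (toAssoc k z)) := by
  induction n with
  | zero =>
    ext d
    rw [coeff_toSeries, nested_zero, atOrigin, pow_zero, Module.End.one_apply, coeff_C]
    by_cases h : d = 0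
    · simp [h]
    · have : ¬(d 0 = 0 ∧ d 1 = 0) := fun h' => h (ext_fin_two h'.1 h'.2)
      simp [h, this]
  | succ n ih =>
    rw [nested_succ, toSeries_conv, ih, pow_succ', Module.End.mul_apply]
    rfl

/-- Multiplication by a variable, which is central, commutes with the operator `ad F`. -/
theorem ad_pow_mul_X (F f : Series k) (i : Fin 2) (n : ℕ) :
    ((LinearMap.mulLeft k F - LinearMap.mulRight k F) ^ n) (f * X i) =
      ((LinearMap.mulLeft k F - LinearMap.mulRight k F) ^ n) f * X i := by
  induction n with
  | zero => simp
  | succ n ih =>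
    rw [pow_succ', Module.End.mul_apply, Module.End.mul_apply, ih]
    simp only [LinearMap.sub_apply, LinearMap.mulLeft_apply, LinearMap.mulRight_apply, sub_mul,
      mul_assoc, X_mul]

theorem coeff_ad_pow_monomial_add (K : ℕ → ℕ → FreeLieAlgebra k (Fin 2)) (i j : Fin 2) (m : ℕ)
    (d : Fin 2 →₀ ℕ) :
    coeff (d + Finsupp.single i 1) (((LinearMap.mulLeft k (toSeries K) -
      LinearMap.mulRight k (toSeries K)) ^ m) (monomial (Finsupp.single i 1) (FreeAlgebra.ι k j)))
      = toAssoc k (nested K (FreeLieAlgebra.of k j) m (d 0) (d 1)) := by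
  have hz : (monomial (Finsupp.single i 1) (FreeAlgebra.ι k j) : Series k) =
      C (toAssoc k (FreeLieAlgebra.of k j)) * X i := by
    rw [X_def, ← monomial_zero_eq_C_apply, monomial_mul_monomial, zero_add, mul_one, toAssoc,
      FreeLieAlgebra.lift_of_apply]
  rw [hz, ad_pow_mul_X, ← toSeries_nested, X_def, coeff_add_mul_monomial, mul_one, coeff_toSeries]

theorem coeff_ad_pow_monomial_of_eq_zero (F : Series k) (i j : Fin 2) (m : ℕ)
    {d : Fin 2 →₀ ℕ} (hd : d i = 0) :
    coeff d (((LinearMap.mulLeft k F - LinearMap.mulRight k F) ^ m)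
      (monomial (Finsupp.single i 1) (FreeAlgebra.ι k j))) = 0 := by
  have hz : (monomial (Finsupp.single i 1) (FreeAlgebra.ι k j) : Series k) =
      C (FreeAlgebra.ι k j) * X i := by
    rw [X_def, ← monomial_zero_eq_C_apply, monomial_mul_monomial, zero_add, mul_one]
  rw [hz, ad_pow_mul_X, X_def, coeff_mul_monomial, if_neg]
  intro h
  have := h i
  simp [hd] at this

/-- For a sign `ε` the recursion in direction `i` is the differential equation
`θ F = (A / (e ^ A - 1)) Z` with `A = ε * ad F`, where `Z` is the `i`-th generator. -/
theorem euler_toSeries [CharZero k] {K : ℕ → ℕ → FreeLieAlgebra k (Fin 2)} (i : Fin 2) {ε : k}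
    (hε : ε ^ 2 = 1) (h0 : K 0 0 = 0)
    (hK : K ((Finsupp.single i 1 : Fin 2 →₀ ℕ) 0) ((Finsupp.single i 1 : Fin 2 →₀ ℕ) 1) =
      FreeLieAlgebra.of k i)
    (hr : ∀ e : Fin 2 →₀ ℕ, (e 0, e 1) ≠ (0, 0) →
      ((e i : k) + 1) • K ((e + Finsupp.single i 1 : Fin 2 →₀ ℕ) 0)
          ((e + Finsupp.single i 1 : Fin 2 →₀ ℕ) 1) =
        (ε * (1 / 2)) • ⁅FreeLieAlgebra.of k i, K (e 0) (e 1)⁆ +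
          bernoulliSum k K (FreeLieAlgebra.of k i) (e 0) (e 1)) (N : ℕ) :
    (N : ℕ∞) ≤ (euler k i (toSeries K) - ∑ m ∈ Finset.range N, bernoulliCoeff k m •
      ((ε • (LinearMap.mulLeft k (toSeries K) - LinearMap.mulRight k (toSeries K))) ^ m)
        (monomial (Finsupp.single i 1) (FreeAlgebra.ι k i))).order := by
  refine nat_le_order fun d hd => ?_
  rw [map_sub, coeff_euler, map_sum, sub_eq_zero]
  simp only [smul_pow, LinearMap.smul_apply, coeff_smul_field]
  by_cases h : d i = 0
  · rw [h, Nat.cast_zero, zero_smul]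
    exact (Finset.sum_eq_zero fun m _ => by
      rw [coeff_ad_pow_monomial_of_eq_zero _ _ _ _ h, smul_zero, smul_zero]).symm
  · obtain ⟨e, rfl⟩ : ∃ e : Fin 2 →₀ ℕ, d = e + Finsupp.single i 1 :=
      ⟨d - Finsupp.single i 1, (tsub_add_cancel_of_le
        (Finsupp.single_le_iff.2 (Nat.one_le_iff_ne_zero.2 h))).symm⟩
    rw [map_add, Finsupp.degree_single, degree_eq] at hd
    simp only [coeff_ad_pow_monomial_add, coeff_toSeries, ← map_smul, ← map_sum]
    congr 1
    rw [Finsupp.add_apply, Finsupp.single_eq_same, Nat.cast_add, Nat.cast_one]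
    by_cases he : (e 0, e 1) = (0, 0)
    · obtain ⟨he0, he1⟩ := Prod.mk.inj he
      obtain rfl : e = 0 := ext_fin_two he0 he1
      obtain ⟨N, rfl⟩ : ∃ M, N = M + 1 := ⟨N - 1, by omega⟩
      rw [zero_add, hK, Finset.sum_range_succ', Finset.sum_eq_zero]
      · simp [bernoulliCoeff_zero, nested_zero, atOrigin]
      · intro m _
        rw [nested_eq_zero h0 _ (by simp), smul_zero, smul_zero]
    · rw [sum_bernoulliCoeff_nested h0 _ hε (by omega), hr e he]

theorem euler_expSeries_of_wRecursion [CharZero k] {K : ℕ → ℕ → FreeLieAlgebra k (Fin 2)}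
    (h0 : K 0 0 = 0) (hK : K 1 0 = FreeLieAlgebra.of k 0)
    (hr : WRecursion k (FreeLieAlgebra.of k 0) K) :
    euler k 0 (expSeries (toSeries K)) =
      monomial (Finsupp.single 0 1) (FreeAlgebra.ι k 0) * expSeries (toSeries K) := by
  refine euler_expSeries_left 0 (constantCoeff_toSeries h0) fun N => ?_
  have := euler_toSeries (K := K) 0 (ε := 1) (one_pow 2) h0 (by simpa using hK)
    (fun e he => by simpa using hr _ _ he) N
  rwa [one_smul] at this

theorem euler_expSeries_of_bRecursion [CharZero k] {K : ℕ → ℕ → FreeLieAlgebra k (Fin 2)}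
    (h0 : K 0 0 = 0) (hK : K 0 1 = FreeLieAlgebra.of k 1)
    (hr : BRecursion k (FreeLieAlgebra.of k 1) K) :
    euler k 1 (expSeries (toSeries K)) =
      expSeries (toSeries K) * monomial (Finsupp.single 1 1) (FreeAlgebra.ι k 1) := by
  refine euler_expSeries_right 1 (constantCoeff_toSeries h0) fun N => ?_
  have := euler_toSeries (K := K) 1 (ε := -1) (by norm_num) h0 (by simpa using hK)
    (fun e he => by simpa using hr _ _ he) N
  have hneg : (-1 : k) • (LinearMap.mulLeft k (toSeries K) - LinearMap.mulRight k (toSeries K)) =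
      LinearMap.mulRight k (toSeries K) - LinearMap.mulLeft k (toSeries K) :=
    (neg_one_smul k (LinearMap.mulLeft k (toSeries K) - LinearMap.mulRight k (toSeries K))).trans
      (neg_sub _ _)
  rwa [hneg] at this

theorem constantCoeff_monomial_single (i : Fin 2) (a : FreeAlgebra k (Fin 2)) :
    (monomial (Finsupp.single i 1) a : Series k).constantCoeff = 0 := by
  rw [← coeff_zero_eq_constantCoeff_apply, coeff_monomial, if_neg]
  exact fun h => by simpa using congrArg (fun d => d i) h

theorem euler_monomial (i : Fin 2) (e : Fin 2 →₀ ℕ) (a : FreeAlgebra k (Fin 2)) :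
    euler k i (monomial e a) = (e i : k) • monomial e a := by
  ext d
  rw [coeff_euler, coeff_smul_field, coeff_monomial]
  split_ifs with h
  · rw [h]
  · simp

theorem euler_expSeries_monomial [CharZero k] (i j : Fin 2) (a : FreeAlgebra k (Fin 2)) :
    euler k i (expSeries (monomial (Finsupp.single j 1) a)) =
      euler k i (monomial (Finsupp.single j 1) a) * expSeries (monomial (Finsupp.single j 1) a) :=
  euler_expSeries_of_commute i (constantCoeff_monomial_single j a) <| by
    rw [euler_monomial]
    exact (Commute.refl _).smul_right _

/-- If `F` and `G` have the same coefficients where the `i`-th variable is absent, then so do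
their exponentials. -/
theorem coeff_expSeries_congr (i : Fin 2) {F G : Series k}
    (h : ∀ d : Fin 2 →₀ ℕ, d i = 0 → coeff d F = coeff d G) {d : Fin 2 →₀ ℕ} (hd : d i = 0) :
    coeff d (expSeries F) = coeff d (expSeries G) := by
  have hp : ∀ (n : ℕ) (d : Fin 2 →₀ ℕ), d i = 0 → coeff d (F ^ n) = coeff d (G ^ n) := by
    intro n
    induction n with
    | zero => intro d _; rw [pow_zero, pow_zero]
    | succ n ih =>
      intro d hd
      rw [pow_succ, pow_succ, coeff_mul, coeff_mul]
      refine Finset.sum_congr rfl fun p hp => ?_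
      rw [mem_antidiagonal] at hp
      have hi : p.1 i + p.2 i = 0 := by rw [← Finsupp.add_apply, hp, hd]
      rw [ih _ (by omega), h _ (by omega)]
  rw [coeff_apply, coeff_apply, expSeries, expSeries]
  exact Finset.sum_congr rfl fun n _ => by rw [hp n d hd]

theorem expSeries_zero : expSeries (0 : Series k) = 1 := by
  ext d
  rw [coeff_expSeries (map_zero _) (Nat.lt_succ_self _), Finset.sum_range_succ',
    Finset.sum_eq_zero]
  · simp
  · intro n _
    simp

theorem coeff_expSeries_monomial_of_eq_zero {i : Fin 2} (a : FreeAlgebra k (Fin 2))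
    {d : Fin 2 →₀ ℕ} (hd : d i = 0) :
    coeff d (expSeries (monomial (Finsupp.single i 1) a)) = coeff d (1 : Series k) := by
  rw [← expSeries_zero]
  refine coeff_expSeries_congr i (fun e he => ?_) hd
  rw [coeff_monomial, if_neg, coeff_zero]
  rintro rfl
  simp at he

theorem coeff_mul_congr (i : Fin 2) {F F' G G' : Series k}
    (hF : ∀ d : Fin 2 →₀ ℕ, d i = 0 → coeff d F = coeff d F')
    (hG : ∀ d : Fin 2 →₀ ℕ, d i = 0 → coeff d G = coeff d G') {d : Fin 2 →₀ ℕ} (hd : d i = 0) :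
    coeff d (F * G) = coeff d (F' * G') := by
  rw [coeff_mul, coeff_mul]
  refine Finset.sum_congr rfl fun p hp => ?_
  rw [mem_antidiagonal] at hp
  have hi : p.1 i + p.2 i = 0 := by rw [← Finsupp.add_apply, hp, hd]
  rw [hF _ (by omega), hG _ (by omega)]

/-- Both `e ^ F` and `e ^ X * e ^ Y` solve `θ E = X * E`, where `θ` is the Euler derivation
counting `X`, and both equal `e ^ Y` in degree `0` in `X`. -/
theorem exp_mul_exp_eq_of_wRecursion [CharZero k] {K : ℕ → ℕ → FreeLieAlgebra k (Fin 2)}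
    (h0 : K 0 0 = 0) (hi : WInitial (FreeLieAlgebra.of k 0) (FreeLieAlgebra.of k 1) K)
    (hr : WRecursion k (FreeLieAlgebra.of k 0) K) :
    expSeries (monomial (Finsupp.single 0 1) (FreeAlgebra.ι k 0) : Series k) *
      expSeries (monomial (Finsupp.single 1 1) (FreeAlgebra.ι k 1) : Series k) =
    expSeries (toSeries K) := by
  refine eq_of_euler_eq_left 0 (constantCoeff_monomial_single 0 _) ?_
    (euler_expSeries_of_wRecursion h0 hi.1 hr) fun d hd => ?_
  · rw [euler_mul, euler_expSeries_monomial, euler_expSeries_monomial, euler_monomial,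
      euler_monomial]
    simp [mul_assoc]
  · rw [coeff_mul_congr 0 (fun e he => coeff_expSeries_monomial_of_eq_zero _ he)
      (fun _ _ => rfl) hd, one_mul]
    refine coeff_expSeries_congr 0 (fun e he => ?_) hd
    rw [coeff_toSeries, coeff_monomial, he]
    split_ifs with h
    · simp [h, hi.2.1, toAssoc]
    · match h1 : e 1 with
      | 0 => rw [h0, map_zero]
      | 1 => exact absurd (ext_fin_two (by simp [he]) (by simp [h1])) h
      | b + 2 => rw [hi.2.2 _ (by omega), map_zero]

/-- Both `e ^ F` and `e ^ X * e ^ Y` solve `θ E = E * Y`, where `θ` is the Euler derivation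
counting `Y`, and both equal `e ^ X` in degree `0` in `Y`. -/
theorem exp_mul_exp_eq_of_bRecursion [CharZero k] {K : ℕ → ℕ → FreeLieAlgebra k (Fin 2)}
    (h0 : K 0 0 = 0) (hi : BInitial (FreeLieAlgebra.of k 0) (FreeLieAlgebra.of k 1) K)
    (hr : BRecursion k (FreeLieAlgebra.of k 1) K) :
    expSeries (monomial (Finsupp.single 0 1) (FreeAlgebra.ι k 0) : Series k) *
      expSeries (monomial (Finsupp.single 1 1) (FreeAlgebra.ι k 1) : Series k) =
    expSeries (toSeries K) := by
  refine eq_of_euler_eq_right 1 (constantCoeff_monomial_single 1 _) ?_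
    (euler_expSeries_of_bRecursion h0 hi.1 hr) fun d hd => ?_
  · have hc : Commute (monomial (Finsupp.single 1 1) (FreeAlgebra.ι k 1) : Series k)
        (expSeries (monomial (Finsupp.single 1 1) (FreeAlgebra.ι k 1))) :=
      commute_expSeries (constantCoeff_monomial_single 1 _) (Commute.refl _)
    rw [euler_mul, euler_expSeries_monomial, euler_expSeries_monomial, euler_monomial,
      euler_monomial]
    simp [mul_assoc, hc.eq]
  · rw [coeff_mul_congr 1 (fun _ _ => rfl)
      (fun e he => coeff_expSeries_monomial_of_eq_zero _ he) hd, mul_one]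
    refine coeff_expSeries_congr 1 (fun e he => ?_) hd
    rw [coeff_toSeries, coeff_monomial, he]
    split_ifs with h
    · simp [h, hi.2.1, toAssoc]
    · match h1 : e 0 with
      | 0 => rw [h0, map_zero]
      | 1 => exact absurd (ext_fin_two (by simp [h1]) (by simp [he])) h
      | b + 2 => rw [hi.2.2 _ (by omega), map_zero]

end Exponentiate

/-! ### The Hausdorff series -/

section Hausdorff

variable {k : Type u} [Field k]

theorem isHausdorffSeries_wSolution [CharZero k] : IsHausdorffSeries k
    (wSolution k (FreeLieAlgebra.of k (0 : Fin 2)) (FreeLieAlgebra.of k 1)) :=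
  ⟨wSolution_mem_bihomogeneous, exp_mul_exp_eq_of_wRecursion (wSolution_zero_zero _ _)
    (wInitial_wSolution _ _) (wRecursion_wSolution _ _)⟩

theorem isHausdorffSeries_bSolution [CharZero k] : IsHausdorffSeries k
    (bSolution k (FreeLieAlgebra.of k (0 : Fin 2)) (FreeLieAlgebra.of k 1)) :=
  ⟨bSolution_mem_bihomogeneous, exp_mul_exp_eq_of_bRecursion (bSolution_zero_zero _ _)
    (bInitial_bSolution _ _) (bRecursion_bSolution _ _)⟩

theorem IsHausdorffSeries.unique [CharZero k] {H H' : ℕ → ℕ → FreeLieAlgebra k (Fin 2)}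
    (h : IsHausdorffSeries k H) (h' : IsHausdorffSeries k H') : H = H' := by
  have hs : toSeries H = toSeries H' :=
    expSeries_injective (constantCoeff_toSeries (bihomogeneous_zero_zero (h.1 0 0)))
      (constantCoeff_toSeries (bihomogeneous_zero_zero (h'.1 0 0))) (h.2.symm.trans h'.2)
  funext w b
  rw [← sub_eq_zero]
  refine eq_zero_of_toAssoc_eq_zero (sub_mem (h.1 w b) (h'.1 w b)) ?_
  have := congrArg (MvPowerSeries.coeff (bidegree w b)) hs
  rw [coeff_toSeries, coeff_toSeries, bidegree_zero, bidegree_one] at this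
  rw [map_sub, this, sub_self]

variable {L : Type v} [LieRing L] [LieAlgebra k L] (x y : L)

theorem evalAt_wInitial {K : ℕ → ℕ → FreeLieAlgebra k (Fin 2)}
    (hK : WInitial (FreeLieAlgebra.of k 0) (FreeLieAlgebra.of k 1) K) :
    WInitial x y fun w b => evalAt k x y (K w b) := by
  refine ⟨?_, ?_, fun b hb => ?_⟩
  · simp [evalAt, hK.1]
  · simp [evalAt, hK.2.1]
  · simp [evalAt, hK.2.2 b hb]

theorem evalAt_bInitial {K : ℕ → ℕ → FreeLieAlgebra k (Fin 2)}
    (hK : BInitial (FreeLieAlgebra.of k 0) (FreeLieAlgebra.of k 1) K) :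
    BInitial x y fun w b => evalAt k x y (K w b) := by
  refine ⟨?_, ?_, fun w hw => ?_⟩
  · simp [evalAt, hK.1]
  · simp [evalAt, hK.2.1]
  · simp [evalAt, hK.2.2 w hw]

theorem evalAt_wRecursion {K : ℕ → ℕ → FreeLieAlgebra k (Fin 2)}
    (hK : WRecursion k (FreeLieAlgebra.of k 0) K) :
    WRecursion k x fun w b => evalAt k x y (K w b) := fun w b h => by
  simp only [evalAt]
  have := congrArg (FreeLieAlgebra.lift k ![x, y]) (hK w b h)
  simpa only [map_smul, map_add, LieHom.map_lie, map_bernoulliSum,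
    FreeLieAlgebra.lift_of_apply, Matrix.cons_val_zero, Matrix.cons_val_one] using this

theorem evalAt_bRecursion {K : ℕ → ℕ → FreeLieAlgebra k (Fin 2)}
    (hK : BRecursion k (FreeLieAlgebra.of k 1) K) :
    BRecursion k y fun w b => evalAt k x y (K w b) := fun w b h => by
  simp only [evalAt]
  have := congrArg (FreeLieAlgebra.lift k ![x, y]) (hK w b h)
  simpa only [map_smul, map_add, LieHom.map_lie, map_bernoulliSum,
    FreeLieAlgebra.lift_of_apply, Matrix.cons_val_zero, Matrix.cons_val_one] using this

end Hausdorff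

end HausdorffSeries

theorem mainTheorem5 (k : Type u) [Field k] [CharZero k] :
    (∃! H : ℕ → ℕ → FreeLieAlgebra k (Fin 2), HausdorffSeries.IsHausdorffSeries k H) ∧
    ∀ H : ℕ → ℕ → FreeLieAlgebra k (Fin 2), HausdorffSeries.IsHausdorffSeries k H →
      ∀ (L : Type v) [LieRing L] [LieAlgebra k L] (x y : L),
        (HausdorffSeries.WInitial x y (fun w b => HausdorffSeries.evalAt k x y (H w b)) ∧
          HausdorffSeries.WRecursion k x (fun w b => HausdorffSeries.evalAt k x y (H w b))) ∧
        (HausdorffSeries.BInitial x y (fun w b => HausdorffSeries.evalAt k x y (H w b)) ∧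
          HausdorffSeries.BRecursion k y (fun w b => HausdorffSeries.evalAt k x y (H w b))) ∧
        (∀ K : ℕ → ℕ → L,
          HausdorffSeries.WInitial x y K → HausdorffSeries.WRecursion k x K →
            ∀ w b, (w, b) ≠ (0, 0) → K w b = HausdorffSeries.evalAt k x y (H w b)) ∧
        (∀ K : ℕ → ℕ → L,
          HausdorffSeries.BInitial x y K → HausdorffSeries.BRecursion k y K →
            ∀ w b, (w, b) ≠ (0, 0) → K w b = HausdorffSeries.evalAt k x y (H w b)) := by
  open HausdorffSeries in
  refine ⟨⟨_, isHausdorffSeries_wSolution, fun H hH => hH.unique isHausdorffSeries_wSolution⟩,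
    fun H hH L _ _ x y => ?_⟩
  have hwi := evalAt_wInitial (k := k) x y (wInitial_wSolution (k := k) _ _)
  have hwr := evalAt_wRecursion (k := k) x y (wRecursion_wSolution _ (FreeLieAlgebra.of k 1))
  have hbi := evalAt_bInitial (k := k) x y (bInitial_bSolution (k := k) _ _)
  have hbr := evalAt_bRecursion (k := k) x y (bRecursion_bSolution (FreeLieAlgebra.of k 0) _)
  rw [← hH.unique isHausdorffSeries_wSolution] at hwi hwr
  rw [← hH.unique isHausdorffSeries_bSolution] at hbi hbr
  exact ⟨⟨hwi, hwr⟩, ⟨hbi, hbr⟩, fun K hi hr => hr.eq hi hwi hwr,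
    fun K hi hr => hr.eq hi hbi hbr⟩
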